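/- **Theorem 3.** Let $G$ be a finite group acting linearly on $\mathbb{C}^n$. For $r\in\mathbb{N}$ let $\mathcal{O}^r_G$ be the (finite-dimensional complex vector) space of $r$-jets at $0$ of $G$-invariant holomorphic function germs $(\mathbb{C}^n,0)\to(\mathbb{C},0)$ with a critical point at the origin, and let $D^r_G$ be the group of $r$-jets of germs of $G$-equivariant biholomorphic maps $(\mathbb{C}^n,0)\to(\mathbb{C}^n,0)$, which acts on $\mathcal{O}^r_G$ by composition, $(j^rf)\cdot(j^r\varphi)=j^r(f\circ\varphi)$. A $G$-invariant holomorphic germ $f:(\mathbb{C}^n,0)\to(\mathbb{C},0)$ with a critical point at the origin is called *equivariantly simple* if there is an $N\in\mathbb{N}$ such that for all sufficiently large $r$ the jet $j^rf$ has a neighbourhood in $\mathcal{O}^r_G$ that intersects at most $N$ orbits of $D^r_G$; it is called *equivariantly stable* if for all sufficiently large $r$ the $D^r_G$-orbit of $j^rf$ is open in $\mathcal{O}^r_G$. Then an equivariantly simple germ exists for the given action of $G$ if and only if an equivariantly stable germ exists for this action. -/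

import Mathlib

open Filter Topology

namespace EquivariantSingularity

/-- The space of `r`-jets at the origin of maps `(ℂⁿ, 0) → F`: tuples of a value and of multilinear
maps of orders `1, …, r`, with the topology of a finite product of normed spaces. -/
abbrev Jet (n r : ℕ) (F : Type) [NormedAddCommGroup F] [NormedSpace ℂ F] : Type :=
  (k : Fin (r + 1)) → ContinuousMultilinearMap ℂ (fun _ : Fin (k : ℕ) => Fin n → ℂ) F

/-- The `r`-jet at the origin of a map: all its derivatives of order at most `r`. -/
noncomputable def jet {n : ℕ} {F : Type} [NormedAddCommGroup F] [NormedSpace ℂ F] (r : ℕ)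
    (f : (Fin n → ℂ) → F) : Jet n r F :=
  fun k => iteratedFDeriv ℂ (k : ℕ) f 0

/-- `f` represents a `G`-invariant holomorphic germ `(ℂⁿ, 0) → (ℂ, 0)` with a critical point at the
origin. -/
structure IsInvariantSingularity {G : Type*} [Group G] {n : ℕ}
    (ρ : Representation ℂ G (Fin n → ℂ)) (f : (Fin n → ℂ) → ℂ) : Prop where
  analyticAt : AnalyticAt ℂ f 0
  invariant : ∀ g : G, ∀ᶠ x in 𝓝 (0 : Fin n → ℂ), f (ρ g x) = f x
  map_zero : f 0 = 0
  critical : fderiv ℂ f 0 = 0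

/-- `φ` represents the germ of a `G`-equivariant biholomorphic map `(ℂⁿ, 0) → (ℂⁿ, 0)`. -/
structure IsEquivariantDiffeo {G : Type*} [Group G] {n : ℕ}
    (ρ : Representation ℂ G (Fin n → ℂ)) (φ : (Fin n → ℂ) → (Fin n → ℂ)) : Prop where
  analyticAt : AnalyticAt ℂ φ 0
  map_zero : φ 0 = 0
  equivariant : ∀ g : G, ∀ᶠ x in 𝓝 (0 : Fin n → ℂ), φ (ρ g x) = ρ g (φ x)
  exists_inverse : ∃ ψ : (Fin n → ℂ) → (Fin n → ℂ), AnalyticAt ℂ ψ 0 ∧ ψ 0 = 0 ∧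
    (∀ᶠ x in 𝓝 (0 : Fin n → ℂ), ψ (φ x) = x) ∧ (∀ᶠ x in 𝓝 (0 : Fin n → ℂ), φ (ψ x) = x)

section Lemmas

variable {G : Type*} [Group G] {n : ℕ} {ρ : Representation ℂ G (Fin n → ℂ)}

theorem tendsto_zero {F : Type} [NormedAddCommGroup F] [NormedSpace ℂ F]
    {φ : (Fin n → ℂ) → F} (h : AnalyticAt ℂ φ 0) (h0 : φ 0 = 0) :
    Tendsto φ (𝓝 0) (𝓝 0) := by
  simpa [h0] using h.continuousAt.tendsto

theorem rep_tendsto_zero (ρ : Representation ℂ G (Fin n → ℂ)) (g : G) :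
    Tendsto (ρ g) (𝓝 0) (𝓝 0) := by
  simpa using (LinearMap.continuous_of_finiteDimensional (ρ g)).tendsto 0

/-- The `r`-jet of a composition only depends on the `r`-jets of the two maps. -/
theorem jet_comp_congr {F : Type} [NormedAddCommGroup F] [NormedSpace ℂ F] [CompleteSpace F] (r : ℕ)
    {f f' : (Fin n → ℂ) → F} {φ φ' : (Fin n → ℂ) → (Fin n → ℂ)}
    (hf : AnalyticAt ℂ f 0) (hf' : AnalyticAt ℂ f' 0)
    (hφ : AnalyticAt ℂ φ 0) (hφ' : AnalyticAt ℂ φ' 0) (hφ0 : φ 0 = 0) (hφ0' : φ' 0 = 0)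
    (h : jet r f = jet r f') (h' : jet r φ = jet r φ') :
    jet r (f ∘ φ) = jet r (f' ∘ φ') := by
  have e : ∀ k ≤ r, iteratedFDeriv ℂ k f 0 = iteratedFDeriv ℂ k f' 0 := fun k hk =>
    congrFun h ⟨k, Nat.lt_succ_of_le hk⟩
  have e' : ∀ k ≤ r, iteratedFDeriv ℂ k φ 0 = iteratedFDeriv ℂ k φ' 0 := fun k hk =>
    congrFun h' ⟨k, Nat.lt_succ_of_le hk⟩
  funext k
  have hk : (k : ℕ) ≤ r := Nat.le_of_lt_succ k.2
  have c1 : ContDiffAt ℂ (k : ℕ) f (φ 0) := by rw [hφ0]; exact hf.contDiffAt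
  have c2 : ContDiffAt ℂ (k : ℕ) f' (φ' 0) := by rw [hφ0']; exact hf'.contDiffAt
  change iteratedFDeriv ℂ (k : ℕ) (f ∘ φ) 0 = iteratedFDeriv ℂ (k : ℕ) (f' ∘ φ') 0
  rw [iteratedFDeriv_comp c1 hφ.contDiffAt le_rfl, iteratedFDeriv_comp c2 hφ'.contDiffAt le_rfl,
    hφ0, hφ0']
  unfold FormalMultilinearSeries.taylorComp
  refine Finset.sum_congr rfl fun c _ => ?_
  ext1 v
  simp only [FormalMultilinearSeries.compAlongOrderedFinpartition_apply, ftaylorSeries,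
    OrderedFinpartition.applyOrderedFinpartition_apply]
  rw [e _ (c.length_le.trans hk)]
  congr 1
  funext m
  rw [e' _ ((c.partSize_le m).trans hk)]

theorem jet_congr {F : Type} [NormedAddCommGroup F] [NormedSpace ℂ F] (r : ℕ)
    {f f' : (Fin n → ℂ) → F} (h : ∀ᶠ x in 𝓝 0, f x = f' x) : jet r f = jet r f' := by
  funext k
  exact (EventuallyEq.iteratedFDeriv ℂ h (k : ℕ)).self_of_nhds

theorem IsEquivariantDiffeo.id : IsEquivariantDiffeo ρ id where
  analyticAt := analyticAt_id
  map_zero := rfl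
  equivariant _ := Eventually.of_forall fun _ => rfl
  exists_inverse := ⟨_root_.id, analyticAt_id, rfl, Eventually.of_forall fun _ => rfl,
    Eventually.of_forall fun _ => rfl⟩

theorem IsEquivariantDiffeo.comp {φ χ : (Fin n → ℂ) → (Fin n → ℂ)}
    (hφ : IsEquivariantDiffeo ρ φ) (hχ : IsEquivariantDiffeo ρ χ) :
    IsEquivariantDiffeo ρ (φ ∘ χ) where
  analyticAt := AnalyticAt.comp (by rw [hχ.map_zero]; exact hφ.analyticAt) hχ.analyticAt
  map_zero := by simp [hχ.map_zero, hφ.map_zero]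
  equivariant g := by
    filter_upwards [hχ.equivariant g,
      (tendsto_zero hχ.analyticAt hχ.map_zero).eventually (hφ.equivariant g)] with x h1 h2
    simp [h1, h2]
  exists_inverse := by
    obtain ⟨ψ, a, z, l, r⟩ := hφ.exists_inverse
    obtain ⟨ψ', a', z', l', r'⟩ := hχ.exists_inverse
    refine ⟨ψ' ∘ ψ, AnalyticAt.comp (by rw [z]; exact a') a, by simp [z, z'], ?_, ?_⟩
    · filter_upwards [l', (tendsto_zero hχ.analyticAt hχ.map_zero).eventually l] with x h1 h2
      simp [h1, h2]
    · filter_upwards [r, (tendsto_zero a z).eventually r'] with x h1 h2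
      simp [h1, h2]

theorem IsEquivariantDiffeo.exists_inv {φ : (Fin n → ℂ) → (Fin n → ℂ)}
    (hφ : IsEquivariantDiffeo ρ φ) : ∃ ψ, IsEquivariantDiffeo ρ ψ ∧
      (∀ᶠ x in 𝓝 (0 : Fin n → ℂ), ψ (φ x) = x) ∧ (∀ᶠ x in 𝓝 (0 : Fin n → ℂ), φ (ψ x) = x) := by
  obtain ⟨ψ, a, z, l, r⟩ := hφ.exists_inverse
  refine ⟨ψ, ⟨a, z, fun g => ?_, φ, hφ.analyticAt, hφ.map_zero, r, l⟩, l, r⟩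
  have t := tendsto_zero a z
  filter_upwards [r, t.eventually (hφ.equivariant g),
    ((rep_tendsto_zero ρ g).comp t).eventually l] with x h1 h2 h3
  have h4 : φ (ρ g (ψ x)) = ρ g x := by rw [h2, h1]
  rw [← h4]
  exact h3

theorem IsInvariantSingularity.comp {f : (Fin n → ℂ) → ℂ} {φ : (Fin n → ℂ) → (Fin n → ℂ)}
    (hf : IsInvariantSingularity ρ f) (hφ : IsEquivariantDiffeo ρ φ) :
    IsInvariantSingularity ρ (f ∘ φ) where
  analyticAt := AnalyticAt.comp (by rw [hφ.map_zero]; exact hf.analyticAt) hφ.analyticAt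
  invariant g := by
    filter_upwards [hφ.equivariant g,
      (tendsto_zero hφ.analyticAt hφ.map_zero).eventually (hf.invariant g)] with x h1 h2
    simp [h1, h2]
  map_zero := by simp [hφ.map_zero, hf.map_zero]
  critical := by
    rw [fderiv_comp (x := 0) (by rw [hφ.map_zero]; exact hf.analyticAt.differentiableAt)
      hφ.analyticAt.differentiableAt, hφ.map_zero, hf.critical, ContinuousLinearMap.zero_comp]

end Lemmas

section Definitions

variable {G : Type*} [Group G] {n : ℕ} (ρ : Representation ℂ G (Fin n → ℂ)) (r : ℕ)

/-- The monoid, under composition, of maps representing germs of equivariant biholomorphic maps. -/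
def diffeoMonoid : Submonoid (Function.End (Fin n → ℂ)) where
  carrier := {φ | IsEquivariantDiffeo ρ φ}
  one_mem' := IsEquivariantDiffeo.id
  mul_mem' h h' := IsEquivariantDiffeo.comp h h'

/-- Two equivariant biholomorphic maps are identified if they have the same `r`-jet. -/
def jetCon : Con (diffeoMonoid ρ) where
  r φ χ := jet r (φ.1 : (Fin n → ℂ) → (Fin n → ℂ)) = jet r (χ.1 : (Fin n → ℂ) → (Fin n → ℂ))
  iseqv := ⟨fun _ => rfl, Eq.symm, Eq.trans⟩
  mul' {w x y z} h h' := by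
    exact jet_comp_congr (f := w.1) (f' := x.1) (φ := y.1) (φ' := z.1) r w.2.analyticAt
      x.2.analyticAt y.2.analyticAt z.2.analyticAt y.2.map_zero z.2.map_zero h h'

/-- `D^r_G`: the `r`-jets of germs of `G`-equivariant biholomorphic maps `(ℂⁿ, 0) → (ℂⁿ, 0)`,
multiplied by composition. -/
def DiffeoJet : Type := (jetCon ρ r).Quotient

instance : Monoid (DiffeoJet ρ r) := inferInstanceAs (Monoid (jetCon ρ r).Quotient)

/-- The element of `D^r_G` represented by an equivariant biholomorphic map. -/
def DiffeoJet.mk (φ : (Fin n → ℂ) → (Fin n → ℂ)) (hφ : IsEquivariantDiffeo ρ φ) :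
    DiffeoJet ρ r :=
  Con.toQuotient (c := jetCon ρ r) ⟨φ, hφ⟩

theorem DiffeoJet.exists_mk (d : DiffeoJet ρ r) : ∃ φ hφ, d = DiffeoJet.mk ρ r φ hφ :=
  Con.induction_on (c := jetCon ρ r) d fun φ => ⟨φ.1, φ.2, rfl⟩

theorem DiffeoJet.mk_eq_mk {φ χ : (Fin n → ℂ) → (Fin n → ℂ)} (hφ : IsEquivariantDiffeo ρ φ)
    (hχ : IsEquivariantDiffeo ρ χ) :
    DiffeoJet.mk ρ r φ hφ = DiffeoJet.mk ρ r χ hχ ↔ jet r φ = jet r χ :=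
  Con.eq (jetCon ρ r)

theorem DiffeoJet.isUnit (d : DiffeoJet ρ r) : IsUnit d := by
  obtain ⟨φ, hφ, rfl⟩ := DiffeoJet.exists_mk ρ r d
  obtain ⟨ψ, hψ, l, m⟩ := hφ.exists_inv
  refine ⟨⟨DiffeoJet.mk ρ r φ hφ, DiffeoJet.mk ρ r ψ hψ, ?_, ?_⟩, rfl⟩
  · exact (DiffeoJet.mk_eq_mk ρ r (hφ.comp hψ) IsEquivariantDiffeo.id).2 (jet_congr r m)
  · exact (DiffeoJet.mk_eq_mk ρ r (hψ.comp hφ) IsEquivariantDiffeo.id).2 (jet_congr r l)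

noncomputable instance : Group (DiffeoJet ρ r) := groupOfIsUnit (DiffeoJet.isUnit ρ r)

/-- `O^r_G`: the space of `r`-jets of `G`-invariant germs `(ℂⁿ, 0) → (ℂ, 0)` with a critical point
at the origin, with the topology induced from the space of all `r`-jets. -/
abbrev SingularityJet : Type :=
  {j : Jet n r ℂ // ∃ f, IsInvariantSingularity ρ f ∧ jet r f = j}

/-- The `r`-jet of an invariant singularity, as a point of `O^r_G`. -/
noncomputable def SingularityJet.of {f : (Fin n → ℂ) → ℂ} (hf : IsInvariantSingularity ρ f) :
    SingularityJet ρ r :=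
  ⟨jet r f, f, hf, rfl⟩

/-- `D^r_G` acts on `O^r_G` from the right by `(j^r f) · (j^r φ) = j^r (f ∘ φ)`. -/
noncomputable instance : SMul (DiffeoJet ρ r)ᵐᵒᵖ (SingularityJet ρ r) where
  smul d j := Con.liftOn (c := jetCon ρ r) d.unop
    (fun φ => SingularityJet.of ρ r (j.2.choose_spec.1.comp φ.2))
    (fun φ χ h => Subtype.ext (jet_comp_congr r j.2.choose_spec.1.analyticAt
      j.2.choose_spec.1.analyticAt φ.2.analyticAt χ.2.analyticAt φ.2.map_zero χ.2.map_zero rfl h))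

theorem smul_of {f : (Fin n → ℂ) → ℂ} (hf : IsInvariantSingularity ρ f)
    {φ : (Fin n → ℂ) → (Fin n → ℂ)} (hφ : IsEquivariantDiffeo ρ φ) :
    MulOpposite.op (DiffeoJet.mk ρ r φ hφ) • SingularityJet.of ρ r hf =
      SingularityJet.of ρ r (hf.comp hφ) := by
  have h := (SingularityJet.of ρ r hf).2.choose_spec
  exact Subtype.ext (jet_comp_congr r h.1.analyticAt hf.analyticAt hφ.analyticAt
    hφ.analyticAt hφ.map_zero hφ.map_zero h.2 rfl)

noncomputable instance : MulAction (DiffeoJet ρ r)ᵐᵒᵖ (SingularityJet ρ r) where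
  one_smul := by
    rintro ⟨_, f, hf, rfl⟩
    exact smul_of ρ r hf IsEquivariantDiffeo.id
  mul_smul := by
    rintro ⟨a⟩ ⟨b⟩ ⟨_, f, hf, rfl⟩
    obtain ⟨φ, hφ, rfl⟩ := DiffeoJet.exists_mk ρ r a
    obtain ⟨χ, hχ, rfl⟩ := DiffeoJet.exists_mk ρ r b
    change MulOpposite.op (DiffeoJet.mk ρ r (χ ∘ φ) (hχ.comp hφ)) • SingularityJet.of ρ r hf =
      MulOpposite.op (DiffeoJet.mk ρ r φ hφ) •
        MulOpposite.op (DiffeoJet.mk ρ r χ hχ) • SingularityJet.of ρ r hf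
    rw [smul_of, smul_of, smul_of]

/-- The `D^r_G`-orbit of a point of `O^r_G`. -/
def jetOrbit (j : SingularityJet ρ r) : Set (SingularityJet ρ r) :=
  MulAction.orbit (DiffeoJet ρ r)ᵐᵒᵖ j

/-- An invariant singularity is equivariantly simple if there is a natural number `N` such that for
all sufficiently large `r` its `r`-jet has a neighbourhood in `O^r_G` which meets at most `N`
orbits of `D^r_G`. -/
def IsEquivariantlySimple (f : (Fin n → ℂ) → ℂ) : Prop :=
  ∃ hf : IsInvariantSingularity ρ f, ∃ N : ℕ, ∀ᶠ r : ℕ in atTop,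
    ∃ U ∈ 𝓝 (SingularityJet.of ρ r hf), (jetOrbit ρ r '' U).encard ≤ N

/-- An invariant singularity is equivariantly stable if for all sufficiently large `r` the
`D^r_G`-orbit of its `r`-jet is open in `O^r_G`. -/
def IsEquivariantlyStable (f : (Fin n → ℂ) → ℂ) : Prop :=
  ∃ hf : IsInvariantSingularity ρ f, ∀ᶠ r : ℕ in atTop,
    IsOpen (jetOrbit ρ r (SingularityJet.of ρ r hf))

end Definitions

end EquivariantSingularity

/-! Call a jet good if the infinitesimal action at it, the derivative at the identity of its orbit
map `v ↦ j ∘ v`, is surjective. Right composition with an invertible jet intertwines the derivatives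
of the orbit map at different points, so the orbit map has constant rank on the open set of
invertible equivariant jets. Hence the orbit of a good jet is open (`isOpen_jetOrbit`), while the
constant rank theorem gives the orbit of any other jet a Hausdorff dimension below that of the jet
space (`dimH_orbit_lt`). Finitely many such thin orbits cannot cover a neighbourhood, so a simple
germ forces good jets to exist in every large order (`exists_surjective_infinitesimalAction`).

Good jets of different orders need not be truncations of one another, and a stable germ must be good
in all large orders at once. The infinitesimal action is linear in the jet, so goodness is an open
condition, and a dense one as soon as a good jet exists. Baire's theorem in a Banach space of
derivative sequences then yields one germ good in all large orders
(`exists_isInvariantSingularity_surjective`).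

Conversely, the open orbit of a stable jet is a neighbourhood that meets a single orbit. -/

namespace EquivariantSingularity

/-! ### Constant rank and Hausdorff dimension of images -/

section ConstantRank

variable {V W : Type*} [NormedAddCommGroup V] [NormedSpace ℂ V] [FiniteDimensional ℂ V]
  [NormedAddCommGroup W] [NormedSpace ℂ W] [FiniteDimensional ℂ W]

theorem exists_continuousLinearMap_retraction (S : Submodule ℂ W) :
    ∃ T : W →L[ℂ] S, ∀ x : S, T x = x := by
  obtain ⟨T, hT⟩ := S.subtype.exists_leftInverse_of_injective S.ker_subtype
  exact ⟨T.toContinuousLinearMap, fun x => LinearMap.congr_fun hT x⟩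

theorem contDiff_codRestrict {E : Type*} [NormedAddCommGroup E] [NormedSpace ℂ E]
    {m : WithTop ℕ∞} {f : E → W} (hf : ContDiff ℂ m f) (S : Submodule ℂ W) (h : ∀ x, f x ∈ S) :
    ContDiff ℂ m (fun x => (⟨f x, h x⟩ : S)) := by
  obtain ⟨T, hT⟩ := exists_continuousLinearMap_retraction S
  have : (fun x => (⟨f x, h x⟩ : S)) = fun x => T (f x) :=
    funext fun x => (hT ⟨f x, h x⟩).symm
  rw [this]
  exact T.contDiff.comp hf

/-- A consequence of the constant rank theorem: locally, the image of a map of constant complex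
rank `k` has Hausdorff dimension at most `2 * k`. -/
theorem exists_nhds_dimH_image_le {P : V → W} (hP : ContDiff ℂ 1 P) {d : V} {k : ℕ}
    (hk : ∀ᶠ v in 𝓝 d, Module.finrank ℂ (fderiv ℂ P v).range = k) :
    ∃ N ∈ 𝓝 d, dimH (P '' N) ≤ (2 * k : ℕ) := by
  set A := fderiv ℂ P d
  obtain ⟨T, hT⟩ := exists_continuousLinearMap_retraction A.range
  obtain ⟨q, hq⟩ := exists_continuousLinearMap_retraction A.ker
  -- A chart straightening `P`: the component of `P` along the range of `A`, completed by a linear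
  -- projection onto the kernel. Its derivative at `d` is bijective, so the inverse function theorem
  -- applies.
  set Φ : V → A.range × A.ker := fun v => (T (P v), q v)
  have hΦc : ContDiff ℂ 1 Φ := (T.contDiff.comp hP).prodMk q.contDiff
  have hPd : ∀ v, HasFDerivAt P (fderiv ℂ P v) v := fun v =>
    (hP.differentiable one_ne_zero v).hasFDerivAt
  have hΦd : ∀ v, HasFDerivAt Φ ((T.comp (fderiv ℂ P v)).prod q) v := fun v =>
    (T.hasFDerivAt.comp v (hPd v)).prodMk q.hasFDerivAt
  have hinj : Function.Injective ((T.comp A).prod q) := by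
    rw [injective_iff_map_eq_zero]
    intro v hv
    have h1 : T (A v) = 0 := congrArg Prod.fst hv
    have h2 : q v = 0 := congrArg Prod.snd hv
    have h3 : A v = 0 := by
      have := hT ⟨A v, v, rfl⟩
      rw [h1] at this
      exact (congrArg Subtype.val this).symm
    have := hq ⟨v, h3⟩
    rw [h2] at this
    exact (congrArg Subtype.val this).symm
  have hfin : Module.finrank ℂ V = Module.finrank ℂ (A.range × A.ker) := by
    rw [Module.finrank_prod]
    exact (LinearMap.finrank_range_add_finrank_ker (A : V →ₗ[ℂ] W)).symm
  let e' : V ≃L[ℂ] A.range × A.ker :=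
    (LinearEquiv.ofInjectiveOfFinrankEq (((T.comp A).prod q) : V →ₗ[ℂ] _) hinj
      hfin).toContinuousLinearEquiv
  have he' : HasFDerivAt Φ (e' : V →L[ℂ] A.range × A.ker) d := by
    have : (e' : V →L[ℂ] A.range × A.ker) = (T.comp A).prod q :=
      ContinuousLinearMap.ext fun _ => rfl
    rw [this]
    exact hΦd d
  let e := hΦc.contDiffAt.toOpenPartialHomeomorph Φ he' one_ne_zero
  have hde : d ∈ e.source := hΦc.contDiffAt.mem_toOpenPartialHomeomorph_source he' one_ne_zero
  have hsd : e.symm (Φ d) = d := e.left_inv hde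
  have hψ : ContDiffAt ℂ 1 e.symm (Φ d) := hΦc.contDiffAt.to_localInverse he' one_ne_zero
  have hk0 : Module.finrank ℂ A.range = k := hk.self_of_nhds
  have hgood : ∀ᶠ y in 𝓝 (Φ d), y ∈ e.target ∧ ContDiffAt ℂ 1 e.symm y ∧
      Module.finrank ℂ (fderiv ℂ P (e.symm y)).range = k := by
    have hk' : ∀ᶠ v in 𝓝 (e.symm (Φ d)), Module.finrank ℂ (fderiv ℂ P v).range = k := by
      rw [hsd]
      exact hk
    exact (e.open_target.eventually_mem (e.map_source hde)).and
      ((hψ.eventually (by simp)).and (hψ.continuousAt.eventually hk'))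
  obtain ⟨ε, hε, hball⟩ := Metric.eventually_nhds_iff_ball.1 hgood
  have hzero : ∀ y ∈ Metric.ball (Φ d) ε, ∀ ζ : A.ker,
      fderiv ℂ P (e.symm y) (fderiv ℂ e.symm y (0, ζ)) = 0 := by
    intro y hy ζ
    obtain ⟨hyt, hyc, hyk⟩ := hball y hy
    set B := fderiv ℂ P (e.symm y)
    have hyd : HasFDerivAt e.symm (fderiv ℂ e.symm y) y :=
      (hyc.differentiableAt one_ne_zero).hasFDerivAt
    -- Differentiating `Φ ∘ e.symm = id`: the first component shows that `T` kills the derivative of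
    -- `P ∘ e.symm` in the kernel directions.
    have hid : ∀ u, ((T.comp B).prod q) (fderiv ℂ e.symm y u) = u := by
      have h1 : HasFDerivAt (Φ ∘ e.symm) (((T.comp B).prod q).comp (fderiv ℂ e.symm y)) y :=
        (hΦd (e.symm y)).comp y hyd
      have h2 : HasFDerivAt (Φ ∘ e.symm) (ContinuousLinearMap.id ℂ _) y := by
        refine (hasFDerivAt_id y).congr_of_eventuallyEq ?_
        filter_upwards [e.open_target.mem_nhds hyt] with z hz
        exact e.right_inv hz
      exact fun u => DFunLike.congr_fun (h1.unique h2) u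
    have hTsurj : Function.Surjective ((T : W →ₗ[ℂ] A.range).domRestrict B.range) := by
      intro a
      refine ⟨⟨B (fderiv ℂ e.symm y (a, 0)), _, rfl⟩, ?_⟩
      exact congrArg Prod.fst (hid (a, 0))
    -- Constancy of the rank enters here: the ranges of `A` and `B` have equal dimension, so the
    -- surjection `T` from one to the other is injective, and a vector of the range of `B` killed by
    -- `T` is zero.
    have hTinj : Function.Injective ((T : W →ₗ[ℂ] A.range).domRestrict B.range) :=
      (LinearMap.injective_iff_surjective_of_finrank_eq_finrank (hyk.trans hk0.symm)).2 hTsurj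
    have := @hTinj ⟨B (fderiv ℂ e.symm y (0, ζ)), _, rfl⟩ 0
      ((congrArg Prod.fst (hid (0, ζ))).trans (map_zero _).symm)
    exact congrArg Subtype.val this
  have hprod : Metric.ball (Φ d) ε = Metric.ball (Φ d).1 ε ×ˢ Metric.ball (Φ d).2 ε :=
    (ball_prod_same _ _ _).symm
  have hconst : ∀ y ∈ Metric.ball (Φ d) ε, P (e.symm y) = P (e.symm (y.1, (Φ d).2)) := by
    rintro ⟨a, b⟩ hab
    rw [hprod, Set.mem_prod] at hab
    have hline : ∀ z ∈ Metric.ball (Φ d).2 ε,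
        HasFDerivAt (fun z => P (e.symm (a, z))) (0 : A.ker →L[ℂ] W) z := by
      intro z hz
      have hmem : (a, z) ∈ Metric.ball (Φ d) ε := by
        rw [hprod]; exact ⟨hab.1, hz⟩
      have h1 := ((hball _ hmem).2.1.differentiableAt one_ne_zero).hasFDerivAt
      have h2 := (hPd (e.symm (a, z))).comp z
        (h1.comp z (hasFDerivAt_prodMk_right a z))
      have h3 : (fderiv ℂ P (e.symm (a, z))).comp ((fderiv ℂ e.symm (a, z)).comp
          (ContinuousLinearMap.inr ℂ A.range A.ker)) = 0 :=
        ContinuousLinearMap.ext fun ζ => hzero _ hmem ζ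
      rw [h3] at h2
      exact h2
    exact Metric.isOpen_ball.is_const_of_fderiv_eq_zero (𝕜 := ℂ)
      (convex_ball _ _).isPreconnected
      (fun z hz => (hline z hz).differentiableAt.differentiableWithinAt)
      (fun z hz => (hline z hz).fderiv) hab.2 (Metric.mem_ball_self hε)
  refine ⟨e.source ∩ Φ ⁻¹' Metric.ball (Φ d) ε, inter_mem (e.open_source.mem_nhds hde)
    (hΦc.continuous.continuousAt (Metric.ball_mem_nhds _ hε)), ?_⟩
  -- In the chart `P` depends only on the first coordinate, so its image is parametrised by a ball
  -- in the `k`-dimensional space `A.range`. The parametrisation is locally Lipschitz and cannot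
  -- raise the dimension.
  have hsub : P '' (e.source ∩ Φ ⁻¹' Metric.ball (Φ d) ε) ⊆
      (fun a => P (e.symm (a, (Φ d).2))) '' Metric.ball (Φ d).1 ε := by
    rintro _ ⟨v, ⟨hv, hvb⟩, rfl⟩
    have hvb' : Φ v ∈ Metric.ball (Φ d) ε := hvb
    refine ⟨(Φ v).1, (hprod ▸ hvb').1, ?_⟩
    refine (hconst _ hvb').symm.trans (congrArg P ?_)
    exact e.left_inv hv
  refine (dimH_mono hsub).trans ?_
  refine (dimH_image_le_of_locally_lipschitzOn fun a ha => ?_).trans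
    ((dimH_mono (Set.subset_univ _)).trans ?_)
  · have hmem : (a, (Φ d).2) ∈ Metric.ball (Φ d) ε := by
      rw [hprod]; exact ⟨ha, Metric.mem_ball_self hε⟩
    have hc : ContDiffAt ℂ 1 (fun a => P (e.symm (a, (Φ d).2))) a :=
      hP.contDiffAt.comp a ((hball _ hmem).2.1.comp a (contDiff_prodMk_left _).contDiffAt)
    obtain ⟨C, t, ht, hCt⟩ := hc.exists_lipschitzOnWith
    exact ⟨C, t, mem_nhdsWithin_of_mem_nhds ht, hCt⟩
  · rw [Real.dimH_univ_eq_finrank, finrank_real_of_complex, hk0]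

/-- The local bound globalises because countably many of the neighbourhoods cover `D` and Hausdorff
dimension is stable under countable unions. -/
theorem dimH_image_le_of_constant_rank {P : V → W} (hP : ContDiff ℂ 1 P) {D : Set V}
    (hD : IsOpen D) {k : ℕ} (hk : ∀ v ∈ D, Module.finrank ℂ (fderiv ℂ P v).range = k) :
    dimH (P '' D) ≤ (2 * k : ℕ) := by
  have h : ∀ d : V, ∃ N, d ∈ D → N ∈ 𝓝 d ∧ dimH (P '' N) ≤ (2 * k : ℕ) := by
    intro d
    by_cases hd : d ∈ D
    · obtain ⟨N, hN, hN'⟩ := exists_nhds_dimH_image_le hP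
        (mem_of_superset (hD.mem_nhds hd) hk)
      exact ⟨N, fun _ => ⟨hN, hN'⟩⟩
    · exact ⟨∅, fun h => absurd h hd⟩
  choose N hN using h
  obtain ⟨t, htD, htc, hcover⟩ := TopologicalSpace.countable_cover_nhdsWithin
    (fun d hd => mem_nhdsWithin_of_mem_nhds (hN d hd).1)
  calc dimH (P '' D) ≤ dimH (P '' ⋃ x ∈ t, N x) := dimH_mono (Set.image_mono hcover)
    _ = ⨆ x ∈ t, dimH (P '' N x) := by rw [Set.image_iUnion₂, dimH_bUnion htc]
    _ ≤ _ := iSup₂_le fun x hx => (hN x (htD hx)).2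

end ConstantRank

/-! ### Genericity of surjective linear maps -/

section Surjective

variable {V W : Type*} [NormedAddCommGroup V] [NormedSpace ℂ V]
  [NormedAddCommGroup W] [NormedSpace ℂ W] [FiniteDimensional ℂ W]

theorem exists_continuousLinearMap_rightInverse {B : V →L[ℂ] W} (hB : Function.Surjective B) :
    ∃ s : W →L[ℂ] V, B.comp s = ContinuousLinearMap.id ℂ W := by
  obtain ⟨s, hs⟩ := (B : V →ₗ[ℂ] W).exists_rightInverse_of_surjective (LinearMap.range_eq_top.2 hB)
  exact ⟨s.toContinuousLinearMap, ContinuousLinearMap.ext fun x => LinearMap.congr_fun hs x⟩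

/-- If `s` is a right inverse of `B`, then `A ∘ s` is close to the identity for `A` near `B`, hence
invertible, which makes `A` surjective. -/
theorem isOpen_setOf_surjective : IsOpen {A : V →L[ℂ] W | Function.Surjective A} := by
  rw [isOpen_iff_mem_nhds]
  intro B hB
  obtain ⟨s, hs⟩ := exists_continuousLinearMap_rightInverse hB
  have : CompleteSpace W := FiniteDimensional.complete ℂ W
  have hc : Continuous fun A : V →L[ℂ] W => A.comp s := by fun_prop
  have hB' : IsUnit (B.comp s) := by rw [hs]; exact isUnit_one
  filter_upwards [hc.continuousAt.preimage_mem_nhds (Units.isOpen.mem_nhds hB')] with A hA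
  obtain ⟨u, hu⟩ := hA
  intro w
  refine ⟨s ((↑u⁻¹ : W →L[ℂ] W) w), ?_⟩
  have h1 : (u : W →L[ℂ] W) ((↑u⁻¹ : W →L[ℂ] W) w) = w := DFunLike.congr_fun u.mul_inv w
  rw [hu] at h1
  exact h1

/-- For a right inverse `s` of `B`, one has `(A + t • B) ∘ s = A ∘ s + t`, which is invertible
unless `-t` is one of the finitely many eigenvalues of `A ∘ s`. -/
theorem finite_setOf_not_surjective_add_smul (A : V →L[ℂ] W) {B : V →L[ℂ] W}
    (hB : Function.Surjective B) : {t : ℂ | ¬ Function.Surjective (A + t • B)}.Finite := by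
  obtain ⟨s, hs⟩ := exists_continuousLinearMap_rightInverse hB
  refine ((Module.End.finite_spectrum (K := ℂ) (V := W) (A.comp s : W →ₗ[ℂ] W)).image
    (fun x => -x)).subset ?_
  intro t ht
  refine ⟨-t, ?_, neg_neg t⟩
  by_contra hnot
  rw [spectrum.notMem_iff] at hnot
  refine ht fun w => ?_
  have hsurj := ((Module.End.isUnit_iff _).1 hnot).surjective (-w)
  obtain ⟨x, hx⟩ := hsurj
  refine ⟨s x, ?_⟩
  have hBs : B (s x) = x := DFunLike.congr_fun hs x
  have hx' : (-t) • x - A (s x) = -w := hx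
  simp only [add_apply, smul_apply, hBs]
  rw [← neg_neg w, ← hx', neg_smul]
  abel

end Surjective

end EquivariantSingularity

namespace EquivariantSingularity

/-! ### Jets as a normed space and their formal composition -/

section Jets

variable {n r : ℕ} {F : Type} [NormedAddCommGroup F] [NormedSpace ℂ F]

/-- The space of `r`-jets, as a normed space. -/
def JetSpace (n r : ℕ) (F : Type) [NormedAddCommGroup F] [NormedSpace ℂ F] : Type := Jet n r F

noncomputable instance : NormedAddCommGroup (JetSpace n r F) :=
  inferInstanceAs (NormedAddCommGroup ((k : Fin (r + 1)) →
    ContinuousMultilinearMap ℂ (fun _ : Fin (k : ℕ) => Fin n → ℂ) F))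

noncomputable instance : NormedSpace ℂ (JetSpace n r F) :=
  inferInstanceAs (NormedSpace ℂ ((k : Fin (r + 1)) →
    ContinuousMultilinearMap ℂ (fun _ : Fin (k : ℕ) => Fin n → ℂ) F))

instance [FiniteDimensional ℂ F] : FiniteDimensional ℂ (JetSpace n r F) := by
  have h : ∀ k : Fin (r + 1), FiniteDimensional ℂ
      (ContinuousMultilinearMap ℂ (fun _ : Fin (k : ℕ) => Fin n → ℂ) F) := fun k =>
    FiniteDimensional.of_injective
      (ContinuousMultilinearMap.toMultilinearMapLinear :
        ContinuousMultilinearMap ℂ (fun _ : Fin (k : ℕ) => Fin n → ℂ) F →ₗ[ℂ] _)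
      ContinuousMultilinearMap.toMultilinearMap_injective
  exact inferInstanceAs (FiniteDimensional ℂ ((k : Fin (r + 1)) →
    ContinuousMultilinearMap ℂ (fun _ : Fin (k : ℕ) => Fin n → ℂ) F))

/-- The component of order `k` of a jet. -/
noncomputable def JetSpace.proj (k : Fin (r + 1)) :
    JetSpace n r F →L[ℂ] ContinuousMultilinearMap ℂ (fun _ : Fin (k : ℕ) => Fin n → ℂ) F :=
  ContinuousLinearMap.proj (R := ℂ) (φ := fun k : Fin (r + 1) =>
    ContinuousMultilinearMap ℂ (fun _ : Fin (k : ℕ) => Fin n → ℂ) F) k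

/-- The `r`-jet of a map, as a point of the normed space of jets. -/
noncomputable def jetAt (r : ℕ) (f : (Fin n → ℂ) → F) : JetSpace n r F := jet r f

theorem jet_add [CompleteSpace F] {f g : (Fin n → ℂ) → F} (hf : AnalyticAt ℂ f 0)
    (hg : AnalyticAt ℂ g 0) :
    jetAt r (f + g) = jetAt r f + jetAt r g :=
  funext fun _ => iteratedFDeriv_add_apply hf.contDiffAt hg.contDiffAt

theorem jet_smul [CompleteSpace F] (c : ℂ) {f : (Fin n → ℂ) → F} (hf : AnalyticAt ℂ f 0) :
    jetAt r (c • f) = c • jetAt r f :=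
  funext fun _ => iteratedFDeriv_const_smul_apply (a := c) hf.contDiffAt

/-- The composition of a jet with the jet of a map preserving the origin, given by the formula of
Faà di Bruno. -/
noncomputable def jetComp (j : JetSpace n r F) (v : JetSpace n r (Fin n → ℂ)) :
    JetSpace n r F := fun k =>
  ∑ c : OrderedFinpartition (k : ℕ), c.compAlongOrderedFinpartitionL ℂ (Fin n → ℂ) (Fin n → ℂ) F
    (JetSpace.proj ⟨c.length, c.length_le.trans_lt k.2⟩ j)
    (fun m => JetSpace.proj ⟨c.partSize m, (c.partSize_le m).trans_lt k.2⟩ v)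

/-- The bridge between the two views of composition: the formula gives linearity in the first jet
and smoothness in the second, while representatives give associativity, units and inverses. -/
theorem jetComp_jet [CompleteSpace F] {f : (Fin n → ℂ) → F} {φ : (Fin n → ℂ) → (Fin n → ℂ)}
    (hf : AnalyticAt ℂ f 0) (hφ : AnalyticAt ℂ φ 0) (hφ0 : φ 0 = 0) :
    jetComp (jetAt r f) (jetAt r φ) = jetAt r (f ∘ φ) := by
  funext k
  have c1 : ContDiffAt ℂ (k : ℕ) f (φ 0) := by rw [hφ0]; exact hf.contDiffAt
  change _ = iteratedFDeriv ℂ (k : ℕ) (f ∘ φ) 0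
  rw [iteratedFDeriv_comp c1 hφ.contDiffAt le_rfl, hφ0]
  rfl

theorem jetComp_add_left (j j' : JetSpace n r F) (v : JetSpace n r (Fin n → ℂ)) :
    jetComp (j + j') v = jetComp j v + jetComp j' v := by
  funext k
  change _ = jetComp j v k + jetComp j' v k
  simp only [jetComp, ← Finset.sum_add_distrib]
  refine Finset.sum_congr rfl fun c _ => ?_
  rw [← add_apply, ← map_add]
  rfl

theorem jetComp_smul_left (c : ℂ) (j : JetSpace n r F) (v : JetSpace n r (Fin n → ℂ)) :
    jetComp (c • j) v = c • jetComp j v := by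
  funext k
  change _ = c • jetComp j v k
  simp only [jetComp, Finset.smul_sum]
  refine Finset.sum_congr rfl fun p _ => ?_
  rw [← smul_apply, ← map_smul]
  rfl

theorem contDiff_jetComp {m : WithTop ℕ∞} (j : JetSpace n r F) :
    ContDiff ℂ m (fun v : JetSpace n r (Fin n → ℂ) => jetComp j v) := by
  refine contDiff_pi.2 fun k => ContDiff.sum fun c _ => ?_
  refine (ContinuousMultilinearMap.contDiff _).comp (contDiff_pi.2 fun m => ?_)
  exact ContinuousLinearMap.contDiff (𝕜 := ℂ) (E := JetSpace n r (Fin n → ℂ))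
    (JetSpace.proj ⟨c.partSize m, (c.partSize_le m).trans_lt k.2⟩)

end Jets

/-! ### Invariant and equivariant jets, orbit maps and the infinitesimal action -/

section Spaces

variable {G : Type*} [Group G] {n : ℕ} (ρ : Representation ℂ G (Fin n → ℂ)) (r : ℕ)

/-- `φ` represents a `G`-equivariant holomorphic germ `(ℂⁿ, 0) → (ℂⁿ, 0)`. -/
structure IsEquivariantMap (φ : (Fin n → ℂ) → (Fin n → ℂ)) : Prop where
  analyticAt : AnalyticAt ℂ φ 0
  map_zero : φ 0 = 0
  equivariant : ∀ g : G, ∀ᶠ x in 𝓝 (0 : Fin n → ℂ), φ (ρ g x) = ρ g (φ x)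

variable {ρ}

theorem IsEquivariantDiffeo.isEquivariantMap {φ : (Fin n → ℂ) → (Fin n → ℂ)}
    (h : IsEquivariantDiffeo ρ φ) : IsEquivariantMap ρ φ :=
  ⟨h.analyticAt, h.map_zero, h.equivariant⟩

theorem IsEquivariantMap.comp {φ χ : (Fin n → ℂ) → (Fin n → ℂ)}
    (hφ : IsEquivariantMap ρ φ) (hχ : IsEquivariantMap ρ χ) : IsEquivariantMap ρ (φ ∘ χ) where
  analyticAt := AnalyticAt.comp (by rw [hχ.map_zero]; exact hφ.analyticAt) hχ.analyticAt
  map_zero := by simp [hχ.map_zero, hφ.map_zero]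
  equivariant g := by
    filter_upwards [hχ.equivariant g,
      (tendsto_zero hχ.analyticAt hχ.map_zero).eventually (hφ.equivariant g)] with x h1 h2
    simp [h1, h2]

theorem IsInvariantSingularity.comp_map {f : (Fin n → ℂ) → ℂ} {φ : (Fin n → ℂ) → (Fin n → ℂ)}
    (hf : IsInvariantSingularity ρ f) (hφ : IsEquivariantMap ρ φ) :
    IsInvariantSingularity ρ (f ∘ φ) where
  analyticAt := AnalyticAt.comp (by rw [hφ.map_zero]; exact hf.analyticAt) hφ.analyticAt
  invariant g := by
    filter_upwards [hφ.equivariant g,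
      (tendsto_zero hφ.analyticAt hφ.map_zero).eventually (hf.invariant g)] with x h1 h2
    simp [h1, h2]
  map_zero := by simp [hφ.map_zero, hf.map_zero]
  critical := by
    rw [fderiv_comp (x := 0) (by rw [hφ.map_zero]; exact hf.analyticAt.differentiableAt)
      hφ.analyticAt.differentiableAt, hφ.map_zero, hf.critical, ContinuousLinearMap.zero_comp]

/-- An equivariant map whose derivative at the origin is invertible is an equivariant
biholomorphic map. -/
theorem IsEquivariantMap.isEquivariantDiffeo {φ : (Fin n → ℂ) → (Fin n → ℂ)}
    (hφ : IsEquivariantMap ρ φ) (h : IsUnit (fderiv ℂ φ 0)) : IsEquivariantDiffeo ρ φ where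
  analyticAt := hφ.analyticAt
  map_zero := hφ.map_zero
  equivariant := hφ.equivariant
  exists_inverse := by
    obtain ⟨u, hu⟩ := h
    let e : (Fin n → ℂ) ≃L[ℂ] (Fin n → ℂ) := ContinuousLinearEquiv.unitsEquiv ℂ _ u
    have he : HasFDerivAt φ (e : (Fin n → ℂ) →L[ℂ] (Fin n → ℂ)) 0 := by
      have : (e : (Fin n → ℂ) →L[ℂ] (Fin n → ℂ)) = fderiv ℂ φ 0 := by
        rw [← hu]; exact ContinuousLinearMap.ext fun _ => rfl
      rw [this]
      exact hφ.analyticAt.differentiableAt.hasFDerivAt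
    -- The order `⊤` stands for analyticity, so the local inverse is analytic as well.
    have hc : ContDiffAt ℂ ⊤ φ 0 := hφ.analyticAt.contDiffAt
    have hs : HasStrictFDerivAt φ (e : (Fin n → ℂ) →L[ℂ] (Fin n → ℂ)) 0 :=
      hc.hasStrictFDerivAt' he (by simp)
    have ha : AnalyticAt ℂ (hc.localInverse he (by simp)) (φ 0) :=
      (hc.to_localInverse he (by simp)).analyticAt
    refine ⟨hc.localInverse he (by simp), ?_, ?_, hs.eventually_left_inverse, ?_⟩
    · rw [hφ.map_zero] at ha; exact ha
    · have := hc.localInverse_apply_image he (by simp)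
      rw [hφ.map_zero] at this; exact this
    · have := hs.eventually_right_inverse
      rw [hφ.map_zero] at this; exact this

theorem IsEquivariantDiffeo.isUnit_fderiv {φ : (Fin n → ℂ) → (Fin n → ℂ)}
    (hφ : IsEquivariantDiffeo ρ φ) : IsUnit (fderiv ℂ φ 0) := by
  obtain ⟨ψ, a, z, l, m⟩ := hφ.exists_inverse
  have h1 : HasFDerivAt φ (fderiv ℂ φ 0) (ψ 0) := by
    rw [z]; exact hφ.analyticAt.differentiableAt.hasFDerivAt
  have h2 : HasFDerivAt ψ (fderiv ℂ ψ 0) (φ 0) := by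
    rw [hφ.map_zero]; exact a.differentiableAt.hasFDerivAt
  have e1 : (fderiv ℂ φ 0).comp (fderiv ℂ ψ 0) = ContinuousLinearMap.id ℂ _ :=
    (h1.comp 0 a.differentiableAt.hasFDerivAt).unique ((hasFDerivAt_id 0).congr_of_eventuallyEq m)
  have e2 : (fderiv ℂ ψ 0).comp (fderiv ℂ φ 0) = ContinuousLinearMap.id ℂ _ :=
    (h2.comp 0 hφ.analyticAt.differentiableAt.hasFDerivAt).unique
      ((hasFDerivAt_id 0).congr_of_eventuallyEq l)
  exact ⟨⟨_, _, e1, e2⟩, rfl⟩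

variable (ρ)

/-- `O^r_G` as a linear subspace of the space of all `r`-jets. -/
def singularityJets : Submodule ℂ (JetSpace n r ℂ) where
  carrier := {j | ∃ f, IsInvariantSingularity ρ f ∧ jetAt r f = j}
  zero_mem' := ⟨0, ⟨analyticAt_const, fun _ => Eventually.of_forall fun _ => rfl, rfl,
    fderiv_const_apply 0⟩, funext fun k => by simp [jetAt, jet]; rfl⟩
  add_mem' := by
    rintro _ _ ⟨f, hf, rfl⟩ ⟨g, hg, rfl⟩
    refine ⟨f + g, ⟨hf.analyticAt.add hg.analyticAt, fun γ => ?_, ?_, ?_⟩,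
      jet_add hf.analyticAt hg.analyticAt⟩
    · filter_upwards [hf.invariant γ, hg.invariant γ] with x h1 h2
      simp [h1, h2]
    · simp [hf.map_zero, hg.map_zero]
    · rw [fderiv_add hf.analyticAt.differentiableAt hg.analyticAt.differentiableAt, hf.critical,
        hg.critical, add_zero]
  smul_mem' := by
    rintro c _ ⟨f, hf, rfl⟩
    refine ⟨c • f, ⟨hf.analyticAt.const_smul, fun γ => ?_, ?_, ?_⟩, jet_smul c hf.analyticAt⟩
    · filter_upwards [hf.invariant γ] with x h1
      simp [h1]
    · simp [hf.map_zero]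
    · rw [fderiv_const_smul hf.analyticAt.differentiableAt, hf.critical, smul_zero]

/-- The space of `r`-jets of `G`-equivariant holomorphic germs `(ℂⁿ, 0) → (ℂⁿ, 0)`. -/
def equivariantJets : Submodule ℂ (JetSpace n r (Fin n → ℂ)) where
  carrier := {j | ∃ φ, IsEquivariantMap ρ φ ∧ jetAt r φ = j}
  zero_mem' := ⟨0, ⟨analyticAt_const, rfl, fun _ => Eventually.of_forall fun _ => by simp⟩,
    funext fun k => by simp [jetAt, jet]; rfl⟩
  add_mem' := by
    rintro _ _ ⟨f, hf, rfl⟩ ⟨g, hg, rfl⟩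
    refine ⟨f + g, ⟨hf.analyticAt.add hg.analyticAt, ?_, fun γ => ?_⟩,
      jet_add hf.analyticAt hg.analyticAt⟩
    · simp [hf.map_zero, hg.map_zero]
    · filter_upwards [hf.equivariant γ, hg.equivariant γ] with x h1 h2
      simp [h1, h2]
  smul_mem' := by
    rintro c _ ⟨f, hf, rfl⟩
    refine ⟨c • f, ⟨hf.analyticAt.const_smul, ?_, fun γ => ?_⟩, jet_smul c hf.analyticAt⟩
    · simp [hf.map_zero]
    · filter_upwards [hf.equivariant γ] with x h1
      simp [h1]

/-- The jets of equivariant biholomorphic maps, as a subset of the space of equivariant jets. -/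
def diffeoJets : Set (equivariantJets ρ r) :=
  {v | ∃ φ, IsEquivariantDiffeo ρ φ ∧ jetAt r φ = v}

/-- Being the jet of a biholomorphic map depends only on invertibility of the linear part, by the
inverse function theorem, and invertibility is open. The order must be at least one for the jet to
contain the linear part. -/
theorem isOpen_diffeoJets (hr : 1 ≤ r) : IsOpen (diffeoJets ρ r) := by
  let lin : equivariantJets ρ r → ((Fin n → ℂ) →L[ℂ] (Fin n → ℂ)) := fun v =>
    continuousMultilinearCurryFin1 ℂ (Fin n → ℂ) (Fin n → ℂ)
      (JetSpace.proj ⟨1, Nat.lt_succ_of_le hr⟩ v.1)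
  have hlin : Continuous lin :=
    (continuousMultilinearCurryFin1 ℂ (Fin n → ℂ) (Fin n → ℂ)).continuous.comp
      ((JetSpace.proj _).continuous.comp continuous_subtype_val)
  have hjet : ∀ (v : equivariantJets ρ r) (φ : (Fin n → ℂ) → (Fin n → ℂ)), jetAt r φ = v →
      lin v = fderiv ℂ φ 0 := by
    intro v φ h
    refine ContinuousLinearMap.ext fun x => ?_
    simp only [lin, ← h, jetAt, continuousMultilinearCurryFin1_apply]
    exact iteratedFDeriv_one_apply _
  have heq : diffeoJets ρ r = lin ⁻¹' {A | IsUnit A} := by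
    ext v
    constructor
    · rintro ⟨φ, hφ, h⟩
      change IsUnit (lin v)
      rw [hjet v φ h]
      exact hφ.isUnit_fderiv
    · intro hv
      obtain ⟨φ, hφ, h⟩ := v.2
      change IsUnit (lin v) at hv
      rw [hjet v φ h] at hv
      exact ⟨φ, hφ.isEquivariantDiffeo hv, h⟩
  rw [heq]
  exact Units.isOpen.preimage hlin

/-- The jet of the identity. -/
noncomputable def idJet : equivariantJets ρ r :=
  ⟨jetAt r id, id, IsEquivariantDiffeo.id.isEquivariantMap, rfl⟩

variable {ρ r}

theorem jetComp_mem_singularityJets {j : JetSpace n r ℂ} (hj : j ∈ singularityJets ρ r)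
    {v : JetSpace n r (Fin n → ℂ)} (hv : v ∈ equivariantJets ρ r) :
    jetComp j v ∈ singularityJets ρ r := by
  obtain ⟨f, hf, rfl⟩ := hj
  obtain ⟨φ, hφ, rfl⟩ := hv
  exact ⟨f ∘ φ, hf.comp_map hφ, (jetComp_jet hf.analyticAt hφ.analyticAt hφ.map_zero).symm⟩

theorem jetComp_mem_equivariantJets {j : JetSpace n r (Fin n → ℂ)} (hj : j ∈ equivariantJets ρ r)
    {v : JetSpace n r (Fin n → ℂ)} (hv : v ∈ equivariantJets ρ r) :
    jetComp j v ∈ equivariantJets ρ r := by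
  obtain ⟨f, hf, rfl⟩ := hj
  obtain ⟨φ, hφ, rfl⟩ := hv
  exact ⟨f ∘ φ, hf.comp hφ, (jetComp_jet hf.analyticAt hφ.analyticAt hφ.map_zero).symm⟩

theorem jetComp_assoc {F : Type} [NormedAddCommGroup F] [NormedSpace ℂ F] [CompleteSpace F]
    {f : (Fin n → ℂ) → F} (hf : AnalyticAt ℂ f 0) {v w : JetSpace n r (Fin n → ℂ)}
    (hv : v ∈ equivariantJets ρ r) (hw : w ∈ equivariantJets ρ r) :
    jetComp (jetComp (jetAt r f) v) w = jetComp (jetAt r f) (jetComp v w) := by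
  obtain ⟨φ, hφ, rfl⟩ := hv
  obtain ⟨ψ, hψ, rfl⟩ := hw
  have hfφ : AnalyticAt ℂ (f ∘ φ) 0 :=
    AnalyticAt.comp (by rw [hφ.map_zero]; exact hf) hφ.analyticAt
  rw [jetComp_jet hf hφ.analyticAt hφ.map_zero, jetComp_jet hfφ hψ.analyticAt hψ.map_zero,
    jetComp_jet hφ.analyticAt hψ.analyticAt hψ.map_zero,
    jetComp_jet hf (hφ.comp hψ).analyticAt (hφ.comp hψ).map_zero]
  rfl

theorem jetComp_idJet {F : Type} [NormedAddCommGroup F] [NormedSpace ℂ F] [CompleteSpace F]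
    {f : (Fin n → ℂ) → F} (hf : AnalyticAt ℂ f 0) :
    jetComp (jetAt r f) (idJet ρ r : JetSpace n r (Fin n → ℂ)) = jetAt r f :=
  jetComp_jet hf analyticAt_id rfl

theorem idJet_jetComp (v : equivariantJets ρ r) :
    jetComp (idJet ρ r : JetSpace n r (Fin n → ℂ)) v = v := by
  obtain ⟨_, φ, hφ, rfl⟩ := v
  exact jetComp_jet analyticAt_id hφ.analyticAt hφ.map_zero

theorem exists_inverse_jet {d : equivariantJets ρ r} (hd : d ∈ diffeoJets ρ r) :
    ∃ d' ∈ diffeoJets ρ r, jetComp (d : JetSpace n r (Fin n → ℂ)) d' = idJet ρ r ∧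
      jetComp (d' : JetSpace n r (Fin n → ℂ)) d = idJet ρ r := by
  obtain ⟨_, hd0⟩ := d
  obtain ⟨φ, hφ, h : jetAt r φ = _⟩ := hd
  subst h
  obtain ⟨ψ, hψ, l, m⟩ := hφ.exists_inv
  refine ⟨⟨jetAt r ψ, ψ, hψ.isEquivariantMap, rfl⟩, ⟨ψ, hψ, rfl⟩, ?_, ?_⟩
  · exact (jetComp_jet hφ.analyticAt hψ.analyticAt hψ.map_zero).trans (jet_congr r m)
  · exact (jetComp_jet hψ.analyticAt hφ.analyticAt hφ.map_zero).trans (jet_congr r l)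

/-- The orbit map `v ↦ j ∘ v` of a jet `j`. -/
noncomputable def orbitMap (j : singularityJets ρ r) (v : equivariantJets ρ r) :
    singularityJets ρ r :=
  ⟨jetComp j v, jetComp_mem_singularityJets j.2 v.2⟩

theorem contDiff_orbitMap {m : WithTop ℕ∞} (j : singularityJets ρ r) :
    ContDiff ℂ m (orbitMap j) :=
  contDiff_codRestrict (f := fun v : equivariantJets ρ r => jetComp j.1 v.1)
    ((contDiff_jetComp j.1).comp (equivariantJets ρ r).subtypeL.contDiff) _
    fun v => jetComp_mem_singularityJets j.2 v.2

theorem hasFDerivAt_orbitMap (j : singularityJets ρ r) (v : equivariantJets ρ r) :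
    HasFDerivAt (orbitMap j) (fderiv ℂ (orbitMap j) v) v :=
  ((contDiff_orbitMap (m := 1) j).differentiable one_ne_zero v).hasFDerivAt

variable (ρ r) in
/-- The infinitesimal action on jets: `j` is sent to the derivative at the identity of its orbit
map. -/
noncomputable def infinitesimalAction :
    singularityJets ρ r →ₗ[ℂ] (equivariantJets ρ r →L[ℂ] singularityJets ρ r) where
  toFun j := fderiv ℂ (orbitMap j) (idJet ρ r)
  map_add' j j' := by
    have : orbitMap (j + j') = orbitMap j + orbitMap j' :=
      funext fun v => Subtype.ext (jetComp_add_left j.1 j'.1 v.1)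
    rw [this]
    exact ((hasFDerivAt_orbitMap j _).add (hasFDerivAt_orbitMap j' _)).fderiv
  map_smul' c j := by
    have : orbitMap (c • j) = c • orbitMap j :=
      funext fun v => Subtype.ext (jetComp_smul_left c j.1 v.1)
    rw [this]
    exact ((hasFDerivAt_orbitMap j _).const_smul c).fderiv

/-- Composition on the right with the jet of an equivariant map, on equivariant jets. -/
noncomputable def rightComp (d : equivariantJets ρ r) :
    equivariantJets ρ r →ₗ[ℂ] equivariantJets ρ r where
  toFun v := ⟨jetComp v d, jetComp_mem_equivariantJets v.2 d.2⟩
  map_add' v w := Subtype.ext (jetComp_add_left v.1 w.1 d.1)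
  map_smul' c v := Subtype.ext (jetComp_smul_left c v.1 d.1)

/-- Composition on the right with the jet of an equivariant map, on jets of singularities. -/
noncomputable def singularityRightComp (d : equivariantJets ρ r) :
    singularityJets ρ r →ₗ[ℂ] singularityJets ρ r where
  toFun j := orbitMap j d
  map_add' v w := Subtype.ext (jetComp_add_left v.1 w.1 d.1)
  map_smul' c v := Subtype.ext (jetComp_smul_left c v.1 d.1)

theorem rightComp_rightComp {d d' : equivariantJets ρ r}
    (h : jetComp (d : JetSpace n r (Fin n → ℂ)) d' = idJet ρ r) (v : equivariantJets ρ r) :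
    rightComp d' (rightComp d v) = v := by
  obtain ⟨_, φ, hφ, rfl⟩ := v
  refine Subtype.ext ((jetComp_assoc hφ.analyticAt d.2 d'.2).trans ?_)
  rw [h]
  exact jetComp_idJet hφ.analyticAt

theorem singularityRightComp_singularityRightComp {d d' : equivariantJets ρ r}
    (h : jetComp (d : JetSpace n r (Fin n → ℂ)) d' = idJet ρ r) (j : singularityJets ρ r) :
    singularityRightComp d' (singularityRightComp d j) = j := by
  obtain ⟨_, f, hf, rfl⟩ := j
  refine Subtype.ext ((jetComp_assoc hf.analyticAt d.2 d'.2).trans ?_)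
  rw [h]
  exact jetComp_idJet hf.analyticAt

theorem bijective_rightComp {d : equivariantJets ρ r} (hd : d ∈ diffeoJets ρ r) :
    Function.Bijective (rightComp d) := by
  obtain ⟨d', -, h, h'⟩ := exists_inverse_jet hd
  exact Function.bijective_iff_has_inverse.2
    ⟨rightComp d', rightComp_rightComp h, rightComp_rightComp h'⟩

theorem bijective_singularityRightComp {d : equivariantJets ρ r} (hd : d ∈ diffeoJets ρ r) :
    Function.Bijective (singularityRightComp d) := by
  obtain ⟨d', -, h, h'⟩ := exists_inverse_jet hd
  exact Function.bijective_iff_has_inverse.2 ⟨singularityRightComp d',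
    singularityRightComp_singularityRightComp h, singularityRightComp_singularityRightComp h'⟩

/-- The derivatives of an orbit map at two points are intertwined by right composition. -/
theorem fderiv_orbitMap_rightComp (j : singularityJets ρ r) (d ξ : equivariantJets ρ r) :
    fderiv ℂ (orbitMap j) d (rightComp d ξ) =
      singularityRightComp d (infinitesimalAction ρ r j ξ) := by
  -- Associativity says that the orbit map commutes with right composition by `d`. Differentiating
  -- this at the identity, which right composition moves to `d`, gives the claim.
  have hid : rightComp d (idJet ρ r) = d := Subtype.ext (idJet_jetComp d)
  have hcomm : orbitMap j ∘ (rightComp d).toContinuousLinearMap =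
      (singularityRightComp d).toContinuousLinearMap ∘ orbitMap j := by
    obtain ⟨_, f, hf, rfl⟩ := j
    exact funext fun v => Subtype.ext (jetComp_assoc hf.analyticAt v.2 d.2).symm
  have h0 : HasFDerivAt (orbitMap j) (fderiv ℂ (orbitMap j) d)
      ((rightComp d).toContinuousLinearMap (idJet ρ r)) := by
    rw [LinearMap.coe_toContinuousLinearMap', hid]
    exact hasFDerivAt_orbitMap j d
  have h1 := h0.comp (idJet ρ r) (rightComp d).toContinuousLinearMap.hasFDerivAt
  rw [hcomm] at h1
  have h2 := (singularityRightComp d).toContinuousLinearMap.hasFDerivAt.comp (idJet ρ r)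
    (hasFDerivAt_orbitMap j (idJet ρ r))
  exact DFunLike.congr_fun (h1.unique h2) ξ

end Spaces
end EquivariantSingularity

namespace EquivariantSingularity

/-! ### Open orbits, thin orbits and the covering argument -/

section Orbits

variable {G : Type*} [Group G] {n : ℕ} {ρ : Representation ℂ G (Fin n → ℂ)} {r : ℕ}

variable (ρ r) in
/-- The space `O^r_G` and the corresponding linear subspace of the space of jets are homeomorphic. -/
noncomputable def singularityJetHomeomorph : SingularityJet ρ r ≃ₜ singularityJets ρ r where
  toFun j := ⟨j.1, j.2⟩
  invFun j := ⟨j.1, j.2⟩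
  left_inv _ := rfl
  right_inv _ := rfl
  continuous_toFun := continuous_id
  continuous_invFun := continuous_id

/-- This turns orbits of the group action into images of an open set under a smooth map, to which
calculus applies. -/
theorem image_jetOrbit (j : SingularityJet ρ r) :
    singularityJetHomeomorph ρ r '' jetOrbit ρ r j =
      orbitMap (singularityJetHomeomorph ρ r j) '' diffeoJets ρ r := by
  obtain ⟨_, f, hf, rfl⟩ := j
  have key : ∀ φ (hφ : IsEquivariantDiffeo ρ φ),
      singularityJetHomeomorph ρ r (MulOpposite.op (DiffeoJet.mk ρ r φ hφ) •
        SingularityJet.of ρ r hf) =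
      orbitMap (singularityJetHomeomorph ρ r (SingularityJet.of ρ r hf))
        ⟨jetAt r φ, φ, hφ.isEquivariantMap, rfl⟩ := by
    intro φ hφ
    rw [smul_of]
    exact Subtype.ext (jetComp_jet hf.analyticAt hφ.analyticAt hφ.map_zero).symm
  ext x
  constructor
  · rintro ⟨_, ⟨d, rfl⟩, rfl⟩
    obtain ⟨φ, hφ, hd⟩ := DiffeoJet.exists_mk ρ r d.unop
    obtain rfl : d = MulOpposite.op (DiffeoJet.mk ρ r φ hφ) := by rw [← hd]; rfl
    exact ⟨_, ⟨φ, hφ, rfl⟩, (key φ hφ).symm⟩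
  · rintro ⟨⟨_, hv⟩, ⟨φ, hφ, h : jetAt r φ = _⟩, rfl⟩
    subst h
    exact ⟨_, ⟨MulOpposite.op (DiffeoJet.mk ρ r φ hφ), rfl⟩, key φ hφ⟩

/-- Surjectivity at the identity spreads to every invertible jet by intertwining, so the orbit map
is a submersion there and therefore open. -/
theorem isOpen_jetOrbit (hr : 1 ≤ r) (j : SingularityJet ρ r)
    (hj : Function.Surjective
      (infinitesimalAction ρ r (singularityJetHomeomorph ρ r j))) :
    IsOpen (jetOrbit ρ r j) := by
  rw [← (singularityJetHomeomorph ρ r).isOpen_image, image_jetOrbit, isOpen_iff_mem_nhds]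
  rintro _ ⟨d, hd, rfl⟩
  set x := singularityJetHomeomorph ρ r j
  have hsurj : Function.Surjective (fderiv ℂ (orbitMap x) d) := by
    intro w
    obtain ⟨y, rfl⟩ := (bijective_singularityRightComp hd).2 w
    obtain ⟨ξ, rfl⟩ := hj y
    exact ⟨rightComp d ξ, fderiv_orbitMap_rightComp x d ξ⟩
  have hstrict : HasStrictFDerivAt (orbitMap x) (fderiv ℂ (orbitMap x) d) d :=
    (contDiff_orbitMap (m := 1) x).contDiffAt.hasStrictFDerivAt one_ne_zero
  have : CompleteSpace (equivariantJets ρ r) := FiniteDimensional.complete ℂ _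
  have : CompleteSpace (singularityJets ρ r) := FiniteDimensional.complete ℂ _
  rw [← hstrict.map_nhds_eq_of_surj (LinearMap.range_eq_top.2 hsurj)]
  exact image_mem_map ((isOpen_diffeoJets ρ r hr).mem_nhds hd)

theorem finrank_range_fderiv_orbitMap (x : singularityJets ρ r) {d : equivariantJets ρ r}
    (hd : d ∈ diffeoJets ρ r) :
    Module.finrank ℂ (fderiv ℂ (orbitMap x) d).range =
      Module.finrank ℂ (infinitesimalAction ρ r x).range := by
  let e := LinearEquiv.ofBijective (singularityRightComp d) (bijective_singularityRightComp hd)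
  have hrange : (fderiv ℂ (orbitMap x) d).range =
      (infinitesimalAction ρ r x).range.map (e : singularityJets ρ r →ₗ[ℂ] _) := by
    ext w
    constructor
    · rintro ⟨v, rfl⟩
      obtain ⟨ξ, rfl⟩ := (bijective_rightComp hd).2 v
      exact ⟨_, ⟨ξ, rfl⟩, (fderiv_orbitMap_rightComp x d ξ).symm⟩
    · rintro ⟨_, ⟨ξ, rfl⟩, rfl⟩
      exact ⟨rightComp d ξ, fderiv_orbitMap_rightComp x d ξ⟩
  rw [hrange, e.finrank_map_eq]

/-- The orbit map has constant rank, equal to that of the infinitesimal action. This rank is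
strictly below the complex dimension, and both double over the reals. -/
theorem dimH_orbit_lt (hr : 1 ≤ r) (x : singularityJets ρ r)
    (hx : ¬ Function.Surjective (infinitesimalAction ρ r x)) :
    dimH (orbitMap x '' diffeoJets ρ r) < Module.finrank ℝ (singularityJets ρ r) := by
  refine (dimH_image_le_of_constant_rank (contDiff_orbitMap x) (isOpen_diffeoJets ρ r hr)
    fun d hd => finrank_range_fderiv_orbitMap x hd).trans_lt ?_
  rw [finrank_real_of_complex, Nat.cast_lt]
  have : Module.finrank ℂ (infinitesimalAction ρ r x).range <
      Module.finrank ℂ (singularityJets ρ r) :=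
    Submodule.finrank_lt fun h => hx (LinearMap.range_eq_top.1 h)
  lia

/-- If a nonempty open set of jets meets only finitely many orbits, then the infinitesimal action is
surjective at some jet. -/
theorem exists_surjective_infinitesimalAction (hr : 1 ≤ r) {j : SingularityJet ρ r}
    {U : Set (SingularityJet ρ r)} (hU : U ∈ 𝓝 j) (hfin : (jetOrbit ρ r '' U).Finite) :
    ∃ x, Function.Surjective (infinitesimalAction ρ r x) := by
  by_contra! hno
  set h := singularityJetHomeomorph ρ r
  -- One representative in `U` for each orbit meeting `U`.
  obtain ⟨t, -, ht⟩ := Set.exists_subset_bijOn U (jetOrbit ρ r)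
  have htfin : t.Finite := ht.finite_iff_finite.2 hfin
  have hcover : h '' U ⊆ ⋃ i ∈ t, orbitMap (h i) '' diffeoJets ρ r := by
    rintro _ ⟨u, hu, rfl⟩
    obtain ⟨i, hi, hiu⟩ := ht.surjOn ⟨u, hu, rfl⟩
    refine Set.mem_iUnion₂.2 ⟨i, hi, ?_⟩
    rw [← image_jetOrbit, hiu]
    exact ⟨u, MulAction.mem_orbit_self u, rfl⟩
  have hlt : dimH (h '' U) < Module.finrank ℝ (singularityJets ρ r) := by
    refine (dimH_mono hcover).trans_lt ?_
    have hpos : (0 : ENNReal) < Module.finrank ℝ (singularityJets ρ r) :=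
      zero_le.trans_lt (dimH_orbit_lt hr (h j) (hno _))
    have hsup : dimH (⋃ i ∈ t, orbitMap (h i) '' diffeoJets ρ r) =
        htfin.toFinset.sup fun i => dimH (orbitMap (h i) '' diffeoJets ρ r) := by
      simp [dimH_bUnion htfin.countable, Finset.sup_eq_iSup]
    rw [hsup, Finset.sup_lt_iff hpos]
    exact fun i _ => dimH_orbit_lt hr (h i) (hno _)
  -- A set of too small dimension has dense complement, so it cannot be a neighbourhood.
  have hdense := dense_compl_of_dimH_lt_finrank hlt
  obtain ⟨x, hx, hx'⟩ := hdense.inter_nhds_nonempty (h.isOpenMap.image_mem_nhds hU)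
  exact hx hx'

end Orbits

/-! ### Invariant singularities with prescribed derivatives -/

section PowerSeries

variable {G : Type*} [Group G] {n : ℕ} (ρ : Representation ℂ G (Fin n → ℂ))

/-- A symmetric and `G`-invariant multilinear form of order `k`, required to vanish for `k ≤ 1`:
these are the possible derivatives of order `k` of invariant singularities. -/
structure IsSingularityCoeff {k : ℕ}
    (c : ContinuousMultilinearMap ℂ (fun _ : Fin k => Fin n → ℂ) ℂ) : Prop where
  symmetric : ∀ (σ : Equiv.Perm (Fin k)) v, c (v ∘ σ) = c v
  invariant : ∀ (g : G) v, c (fun i => ρ g (v i)) = c v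
  vanishing : k ≤ 1 → ∀ v, c v = 0

variable {ρ}

theorem IsInvariantSingularity.isSingularityCoeff {f : (Fin n → ℂ) → ℂ}
    (hf : IsInvariantSingularity ρ f) (k : ℕ) :
    IsSingularityCoeff ρ (iteratedFDeriv ℂ k f 0) where
  symmetric σ v := ContDiffAt.iteratedFDeriv_comp_perm hf.analyticAt.contDiffAt v σ
  invariant g v := by
    let e : (Fin n → ℂ) ≃L[ℂ] (Fin n → ℂ) :=
      (LinearEquiv.ofBijective (ρ g) (ρ.apply_bijective g)).toContinuousLinearEquiv
    have h1 : iteratedFDeriv ℂ k (f ∘ e) 0 = iteratedFDeriv ℂ k f 0 :=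
      (EventuallyEq.iteratedFDeriv ℂ (hf.invariant g) k).self_of_nhds
    have h2 := e.iteratedFDerivWithin_comp_right f uniqueDiffOn_univ (Set.mem_univ (e 0)) k
    rw [Set.preimage_univ, iteratedFDerivWithin_univ, iteratedFDerivWithin_univ, h1,
      _root_.map_zero e] at h2
    exact (DFunLike.congr_fun h2 v).symm
  vanishing hk v := by
    obtain rfl | rfl : k = 0 ∨ k = 1 := by lia
    · rw [iteratedFDeriv_zero_apply, hf.map_zero]
    · rw [iteratedFDeriv_one_apply, hf.critical]
      rfl

/-- A bounded sequence of symmetric invariant forms is the sequence of derivatives of an invariant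
singularity. -/
theorem exists_singularity_of_coeff
    {c : (k : ℕ) → ContinuousMultilinearMap ℂ (fun _ : Fin k => Fin n → ℂ) ℂ}
    (hc : ∀ k, IsSingularityCoeff ρ (c k)) {C : ℝ} (hC : ∀ k, ‖c k‖ ≤ C) :
    ∃ f, IsInvariantSingularity ρ f ∧ ∀ k, iteratedFDeriv ℂ k f 0 = c k := by
  -- The derivative of order `k` of the sum adds the `k`-th term over all `k!` permutations, which
  -- agree by symmetry, so the factor `1 / k!` recovers `c k`. Boundedness of `c` makes the radius
  -- at least one.
  let p : FormalMultilinearSeries ℂ (Fin n → ℂ) ℂ := fun k => ((k.factorial : ℂ)⁻¹) • c k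
  have hrad : (1 : NNReal) ≤ p.radius := by
    refine p.le_radius_of_bound C fun k => ?_
    have h1 : ‖((k.factorial : ℂ)⁻¹)‖ ≤ 1 := by
      rw [norm_inv, Complex.norm_natCast]
      exact inv_le_one_of_one_le₀ (by exact_mod_cast k.factorial_pos)
    calc ‖p k‖ * ((1 : NNReal) : ℝ) ^ k = ‖((k.factorial : ℂ)⁻¹) • c k‖ := by simp [p]
      _ ≤ ‖((k.factorial : ℂ)⁻¹)‖ * ‖c k‖ := (norm_smul _ (c k)).le
      _ ≤ 1 * ‖c k‖ := by gcongr
      _ ≤ C := by rw [one_mul]; exact hC k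
  have hser : HasFPowerSeriesOnBall p.sum p 0 p.radius :=
    p.hasFPowerSeriesOnBall (lt_of_lt_of_le (by simp) hrad)
  have hder : ∀ k, iteratedFDeriv ℂ k p.sum 0 = c k := by
    intro k
    ext v
    rw [hser.iteratedFDeriv_eq_sum_of_completeSpace]
    have : ∀ σ : Equiv.Perm (Fin k), p k (fun i => v (σ i)) = (k.factorial : ℂ)⁻¹ * c k v :=
      fun σ => congrArg (fun z => (k.factorial : ℂ)⁻¹ * z) ((hc k).symmetric σ v)
    rw [Finset.sum_congr rfl fun σ _ => this σ, Finset.sum_const, Finset.card_univ,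
      Fintype.card_perm, Fintype.card_fin, nsmul_eq_mul, mul_inv_cancel_left₀]
    exact_mod_cast k.factorial_ne_zero
  refine ⟨p.sum, ⟨hser.analyticAt, fun g => Eventually.of_forall fun x => ?_, ?_, ?_⟩, hder⟩
  · refine tsum_congr fun k => ?_
    exact congrArg (fun z => (k.factorial : ℂ)⁻¹ * z) ((hc k).invariant g fun _ => x)
  · have := (hc 0).vanishing zero_le_one 0
    rwa [← hder 0, iteratedFDeriv_zero_apply] at this
  · ext1 x
    have := (hc 1).vanishing le_rfl (fun _ => x)
    rwa [← hder 1, iteratedFDeriv_one_apply] at this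

/-! ### The Banach space of derivative sequences and the Baire argument -/

/-- Bounded sequences of multilinear forms. -/
abbrev CoeffSpace (n : ℕ) : Type :=
  lp (fun k : ℕ => ContinuousMultilinearMap ℂ (fun _ : Fin k => Fin n → ℂ) ℂ) ⊤

variable (ρ)

/-- Bounded sequences of derivatives of invariant singularities, as a subspace of the Banach space of
all bounded sequences of multilinear forms. -/
def singularitySeries : Submodule ℂ (CoeffSpace n) where
  carrier := {c | ∀ k, IsSingularityCoeff ρ (c k)}
  zero_mem' _ := ⟨fun _ _ => rfl, fun _ _ => rfl, fun _ _ => rfl⟩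
  add_mem' hc hc' k :=
    ⟨fun σ v => congrArg₂ (· + ·) ((hc k).symmetric σ v) ((hc' k).symmetric σ v),
      fun g v => congrArg₂ (· + ·) ((hc k).invariant g v) ((hc' k).invariant g v),
      fun h v => (congrArg₂ (· + ·) ((hc k).vanishing h v) ((hc' k).vanishing h v)).trans
        (add_zero 0)⟩
  smul_mem' t _ hc k :=
    ⟨fun σ v => congrArg (t • ·) ((hc k).symmetric σ v),
      fun g v => congrArg (t • ·) ((hc k).invariant g v),
      fun h v => (congrArg (t • ·) ((hc k).vanishing h v)).trans (smul_zero t)⟩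

theorem continuous_coeff_apply {k : ℕ} (v : Fin k → Fin n → ℂ) :
    Continuous fun c : CoeffSpace n => c k v :=
  (ContinuousMultilinearMap.apply ℂ (fun _ : Fin k => Fin n → ℂ) ℂ v).continuous.comp
    (lp.evalCLM ℂ (fun k : ℕ => ContinuousMultilinearMap ℂ (fun _ : Fin k => Fin n → ℂ) ℂ)
      ⊤ k).continuous

/-- The defining conditions are equations between continuous evaluations. Closedness gives
completeness, which Baire's theorem needs. -/
theorem isClosed_singularitySeries : IsClosed (singularitySeries ρ : Set (CoeffSpace n)) := by
  have : (singularitySeries ρ : Set (CoeffSpace n)) =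
      ⋂ k : ℕ, ((⋂ (σ : Equiv.Perm (Fin k)) (v : Fin k → Fin n → ℂ), {c | c k (v ∘ σ) = c k v}) ∩
        ((⋂ (g : G) (v : Fin k → Fin n → ℂ), {c | c k (fun i => ρ g (v i)) = c k v}) ∩
        ⋂ (_ : k ≤ 1) (v : Fin k → Fin n → ℂ), {c | c k v = 0})) := by
    ext c
    simp only [Set.mem_iInter, Set.mem_inter_iff, Set.mem_ofPred_eq]
    exact forall_congr' fun k => ⟨fun h => ⟨h.symmetric, h.invariant, h.vanishing⟩,
      fun h => ⟨h.1, h.2.1, h.2.2⟩⟩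
  rw [this]
  refine isClosed_iInter fun k => IsClosed.inter ?_ (IsClosed.inter ?_ ?_)
  · exact isClosed_iInter fun σ => isClosed_iInter fun v =>
      isClosed_eq (continuous_coeff_apply _) (continuous_coeff_apply _)
  · exact isClosed_iInter fun g => isClosed_iInter fun v =>
      isClosed_eq (continuous_coeff_apply _) (continuous_coeff_apply _)
  · exact isClosed_iInter fun _ => isClosed_iInter fun v =>
      isClosed_eq (continuous_coeff_apply _) continuous_const

instance : CompleteSpace (singularitySeries ρ) :=
  (isClosed_singularitySeries ρ).completeSpace_coe

variable {ρ}

theorem exists_singularity_of_series (c : singularitySeries ρ) :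
    ∃ f, IsInvariantSingularity ρ f ∧ ∀ k, iteratedFDeriv ℂ k f 0 = c.1 k :=
  exists_singularity_of_coeff c.2 fun k => lp.norm_apply_le_norm ENNReal.top_ne_zero c.1 k

/-- The `r`-jet defined by a sequence of derivatives. -/
def truncation (r : ℕ) (c : singularitySeries ρ) : singularityJets ρ r :=
  ⟨fun k => c.1 k, by
    obtain ⟨f, hf, h⟩ := exists_singularity_of_series c
    exact ⟨f, hf, funext fun k => h k⟩⟩

theorem continuous_truncation (r : ℕ) : Continuous (truncation (ρ := ρ) r) := by
  refine Continuous.subtype_mk (continuous_pi fun k : Fin (r + 1) => ?_) _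
  exact (lp.evalCLM ℂ (fun k : ℕ => ContinuousMultilinearMap ℂ (fun _ : Fin k => Fin n → ℂ) ℂ)
    ⊤ (k : ℕ)).continuous.comp continuous_subtype_val

theorem truncation_add_smul (r : ℕ) (c w : singularitySeries ρ) (t : ℂ) :
    truncation r (c + t • w) = truncation r c + t • truncation r w := rfl

theorem surjective_truncation (r : ℕ) : Function.Surjective (truncation (ρ := ρ) r) := by
  rintro ⟨_, f, hf, rfl⟩
  let c : (k : ℕ) → ContinuousMultilinearMap ℂ (fun _ : Fin k => Fin n → ℂ) ℂ :=
    -- Derivatives above order `r` are replaced by zero, since those of `f` may be unbounded.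
    fun k => if k ≤ r then iteratedFDeriv ℂ k f 0 else 0
  have hmem : Memℓp c ⊤ := by
    refine memℓp_infty ⟨∑ k ∈ Finset.range (r + 1), ‖iteratedFDeriv ℂ k f 0‖, ?_⟩
    rintro _ ⟨k, rfl⟩
    by_cases hk : k ≤ r
    · simp only [c, if_pos hk]
      exact Finset.single_le_sum (f := fun k => ‖iteratedFDeriv ℂ k f 0‖)
        (fun _ _ => norm_nonneg _) (Finset.mem_range.2 (Nat.lt_succ_of_le hk))
    · simp only [c, if_neg hk, norm_zero]
      exact Finset.sum_nonneg fun _ _ => norm_nonneg _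
  refine ⟨⟨⟨c, hmem⟩, fun k => ?_⟩, ?_⟩
  · change IsSingularityCoeff ρ (c k)
    by_cases hk : k ≤ r
    · simp only [c, if_pos hk]
      exact hf.isSingularityCoeff k
    · simp only [c, if_neg hk]
      exact ⟨fun _ _ => rfl, fun _ _ => rfl, fun _ _ => rfl⟩
  · refine Subtype.ext (funext fun k => ?_)
    exact if_pos (Nat.le_of_lt_succ k.2)

theorem isOpen_setOf_surjective_truncation (r : ℕ) :
    IsOpen {c : singularitySeries ρ |
      Function.Surjective (infinitesimalAction ρ r (truncation r c))} :=
  isOpen_setOf_surjective.preimage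
    ((LinearMap.continuous_of_finiteDimensional (infinitesimalAction ρ r)).comp
      (continuous_truncation r))

/-- On the complex line through any `c` in the direction of a lift `w` of a good jet, only finitely
many parameters are bad, so good points accumulate at `c`. -/
theorem dense_setOf_surjective_truncation {r : ℕ}
    (h : ∃ x, Function.Surjective (infinitesimalAction ρ r x)) :
    Dense {c : singularitySeries ρ |
      Function.Surjective (infinitesimalAction ρ r (truncation r c))} := by
  obtain ⟨x, hx⟩ := h
  obtain ⟨w, rfl⟩ := surjective_truncation r x
  intro c
  have hfin := finite_setOf_not_surjective_add_smul (infinitesimalAction ρ r (truncation r c)) hx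
  have hdense := (hfin.countable.dense_compl ℂ) 0
  have hcont : Continuous fun t : ℂ => c + t • w := by fun_prop
  have := map_mem_closure hcont hdense (t := {c : singularitySeries ρ |
      Function.Surjective (infinitesimalAction ρ r (truncation r c))}) ?_
  · simpa using this
  · intro t ht
    have ht' := not_not.1 ht
    change Function.Surjective (infinitesimalAction ρ r (truncation r (c + t • w)))
    rwa [truncation_add_smul, map_add, map_smul]

/-- There is a single germ whose jets of all high orders have surjective infinitesimal action,
provided that there are such jets of all high orders. -/
theorem exists_isInvariantSingularity_surjective
    (h : ∀ᶠ r : ℕ in atTop, ∃ x, Function.Surjective (infinitesimalAction ρ r x)) :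
    ∃ (f : (Fin n → ℂ) → ℂ) (hf : IsInvariantSingularity ρ f), ∀ᶠ r : ℕ in atTop,
      Function.Surjective (infinitesimalAction ρ r
        (singularityJetHomeomorph ρ r (SingularityJet.of ρ r hf))) := by
  obtain ⟨r₀, hr₀⟩ := eventually_atTop.1 h
  -- Baire's theorem, applied to one open dense condition for each order `r₀ + m`.
  obtain ⟨c, hc⟩ := (dense_iInter_of_isOpen_nat
    (fun m => isOpen_setOf_surjective_truncation (ρ := ρ) (r₀ + m))
    (fun m => dense_setOf_surjective_truncation (hr₀ _ (Nat.le_add_right _ _)))).nonempty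
  obtain ⟨f, hf, hfc⟩ := exists_singularity_of_series c
  refine ⟨f, hf, eventually_atTop.2 ⟨r₀, fun r hr => ?_⟩⟩
  obtain ⟨m, rfl⟩ := Nat.exists_eq_add_of_le hr
  have hjet : singularityJetHomeomorph ρ (r₀ + m) (SingularityJet.of ρ (r₀ + m) hf) =
      truncation (r₀ + m) c := Subtype.ext (funext fun k => hfc k)
  rw [hjet]
  exact Set.mem_iInter.1 hc m

end PowerSeries

end EquivariantSingularity

theorem theorem3 {G : Type*} [Group G] [Finite G] {n : ℕ}
    (ρ : Representation ℂ G (Fin n → ℂ)) :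
    (∃ f : (Fin n → ℂ) → ℂ, EquivariantSingularity.IsEquivariantlySimple ρ f) ↔
      ∃ f : (Fin n → ℂ) → ℂ, EquivariantSingularity.IsEquivariantlyStable ρ f := by
  open EquivariantSingularity in
  constructor
  · rintro ⟨f, hf, N, hN⟩
    obtain ⟨f', hf', hsurj⟩ := exists_isInvariantSingularity_surjective (ρ := ρ) (by
      filter_upwards [hN, eventually_ge_atTop 1] with r ⟨U, hU, hcard⟩ hr
      exact exists_surjective_infinitesimalAction hr hU
        (Set.finite_of_encard_le_coe hcard))
    refine ⟨f', hf', ?_⟩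
    filter_upwards [hsurj, eventually_ge_atTop 1] with r hs hr
    exact isOpen_jetOrbit hr _ hs
  · rintro ⟨f, hf, hopen⟩
    refine ⟨f, hf, 1, ?_⟩
    filter_upwards [hopen] with r hr
    -- The neighbourhood is the open orbit itself, so `N = 1` works for every large `r`.
    refine ⟨_, hr.mem_nhds (MulAction.mem_orbit_self _), ?_⟩
    rw [Nat.cast_one, Set.encard_le_one_iff]
    rintro _ _ ⟨a, ha, rfl⟩ ⟨b, hb, rfl⟩
    exact (MulAction.orbit_eq_iff.2 ha).trans (MulAction.orbit_eq_iff.2 hb).symm
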